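/- Let $q_1,q_2\ge 1$ be integers with $(q_1,q_2)=1$ and $q_1\neq 1$, and put $N=q_1q_2$. Let $\chi_1,\chi_2$ be primitive Dirichlet characters modulo $q_1,q_2$ (the character modulo $1$ being $\chi(n)=1$ for all $n$), with $\chi_1(-1)\chi_2(-1)=1$. For $z$ in the upper half plane $\mathbb H$ let $$F_{\chi_1,\chi_2}(z)=c_1z+c_0+\sum_{n\ge 1}\frac{\lambda_{\chi_1,\chi_2}(n,1)}{\sqrt n}\,e^{2\pi i n z},\qquad \lambda_{\chi_1,\chi_2}(n,s)=\sum_{ab=n}\chi_1(a)\overline{\chi_2}(b)\,(b/a)^{s-\frac12},$$ where $c_1=\pi i\,L(-1,\overline{\chi_2})$ if $q_1=1$ and $c_1=0$ otherwise, and $c_0=\tfrac12L(1,\chi_1)$ if $q_2=1$ and $c_0=0$ otherwise. For $\gamma=\begin{pmatrix}a&b\\c&d\end{pmatrix}\in\Gamma_0(N)$ put $\psi(\gamma)=\chi_1(d)\overline{\chi_2}(d)$ and define the newform Dedekind sum by $$S_{\chi_1,\chi_2}(\gamma)=\frac{\tau(\overline{\chi_1})}{\pi i}\bigl(F_{\chi_1,\chi_2}(\gamma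 z)-\psi(\gamma)F_{\chi_1,\chi_2}(z)\bigr),\qquad \tau(\chi)=\sum_{j\bmod q}\chi(j)e^{2\pi i j/q}\ \text{ for }\chi\text{ modulo }q.$$ The right-hand side does not depend on $z\in\mathbb H$, and, since $q_1\ne1$, it depends only on the left column $(a,c)$ of $\gamma$; write $S_{\chi_1,\chi_2}(a,c)$ for it. Let $r$ be an integer with $(r,q_2)=1$. Then for every nonzero integer $k$ and each choice of sign, there is a matrix in $\Gamma_0(N)$ with left column $(\pm1+Nkr,\,Nkq_2)$, the value $S_{\chi_1,\chi_2}(\pm1+Nkr,\,Nkq_2)$ is well defined (independent of $z$ and of the matrix), and $$S_{\chi_1,\chi_2}(\pm 1+Nkr,\;Nkq_2)\neq 0 .$$ -/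

import Mathlib

open scoped MatrixGroups

noncomputable section

namespace NewformDedekind

/-- The divisor sum `λ_{χ₁,χ₂}(n, s) = ∑_{ab = n} χ₁(a) \bar{χ₂}(b) (b/a)^{s - 1/2}` for `n ≥ 1`.
The complex conjugate of a Dirichlet character is its inverse `χ⁻¹`. -/
def lam {q₁ q₂ : ℕ} (χ₁ : DirichletCharacter ℂ q₁) (χ₂ : DirichletCharacter ℂ q₂)
    (n : ℕ+) (s : ℂ) : ℂ :=
  ∑ p ∈ (n : ℕ).divisorsAntidiagonal,
    χ₁ (p.1 : ZMod q₁) * χ₂⁻¹ (p.2 : ZMod q₂) * ((p.2 : ℂ) / (p.1 : ℂ)) ^ (s - 1 / 2)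

/-- The coefficient `c₁ = δ_{q₁ = 1} π i L(-1, \bar{χ₂})`. -/
def cOne {q₂ : ℕ} [NeZero q₂] (q₁ : ℕ) (χ₂ : DirichletCharacter ℂ q₂) : ℂ :=
  if q₁ = 1 then (Real.pi : ℂ) * Complex.I * DirichletCharacter.LFunction χ₂⁻¹ (-1) else 0

/-- The coefficient `c₀ = δ_{q₂ = 1} L(1, χ₁) / 2`. -/
def cZero {q₁ : ℕ} [NeZero q₁] (χ₁ : DirichletCharacter ℂ q₁) (q₂ : ℕ) : ℂ :=
  if q₂ = 1 then 1 / 2 * DirichletCharacter.LFunction χ₁ 1 else 0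

variable {q₁ q₂ : ℕ} [NeZero q₁] [NeZero q₂]

/-- The holomorphic function
`F_{χ₁,χ₂}(z) = c₁ z + c₀ + ∑_{n ≥ 1} (λ_{χ₁,χ₂}(n, 1) / √n) e(nz)` on the upper half plane. -/
def F (χ₁ : DirichletCharacter ℂ q₁) (χ₂ : DirichletCharacter ℂ q₂) (z : UpperHalfPlane) : ℂ :=
  cOne q₁ χ₂ * (z : ℂ) + cZero χ₁ q₂ +
    ∑' n : ℕ+, lam χ₁ χ₂ n 1 / (Real.sqrt ((n : ℕ) : ℝ) : ℂ) *
      Complex.exp (2 * Real.pi * Complex.I * ((n : ℕ) : ℂ) * (z : ℂ))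

/-- The character `ψ = χ₁ \bar{χ₂}` of `Γ₀(q₁ q₂)`, evaluated at the lower right entry of `γ`. -/
def psi (χ₁ : DirichletCharacter ℂ q₁) (χ₂ : DirichletCharacter ℂ q₂) (γ : SL(2, ℤ)) : ℂ :=
  χ₁ ((γ 1 1 : ℤ) : ZMod q₁) * χ₂⁻¹ ((γ 1 1 : ℤ) : ZMod q₂)

/-- `φ_{χ₁,χ₂}(γ, z) = F_{χ₁,χ₂}(γ z) - ψ(γ) F_{χ₁,χ₂}(z)`. -/
def phi (χ₁ : DirichletCharacter ℂ q₁) (χ₂ : DirichletCharacter ℂ q₂) (γ : SL(2, ℤ))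
    (z : UpperHalfPlane) : ℂ :=
  F χ₁ χ₂ (γ • z) - psi χ₁ χ₂ γ * F χ₁ χ₂ z

/-- `τ(\bar{χ₁}) / (π i) · φ_{χ₁,χ₂}(γ, z)`, where `τ(χ) = ∑_{j mod q} χ(j) e(j/q)`. For
`γ ∈ Γ₀(q₁ q₂)` this does not depend on `z`, and the common value is the newform Dedekind
sum `S_{χ₁,χ₂}(γ)`. -/
def dedekindSumAt (χ₁ : DirichletCharacter ℂ q₁) (χ₂ : DirichletCharacter ℂ q₂) (γ : SL(2, ℤ))
    (z : UpperHalfPlane) : ℂ :=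
  gaussSum χ₁⁻¹ ZMod.stdAddChar / ((Real.pi : ℂ) * Complex.I) * phi χ₁ χ₂ γ z

/-- The newform Dedekind sum `S_{χ₁,χ₂}(a, c)` is well defined and equal to `s`: there is a matrix
in `Γ₀(q₁ q₂)` with left column `(a, c)`, and for every such matrix `γ` the value
`τ(\bar{χ₁}) / (π i) · φ_{χ₁,χ₂}(γ, z)` is `s`, whatever the point `z` is. -/
def HasDedekindSum (χ₁ : DirichletCharacter ℂ q₁) (χ₂ : DirichletCharacter ℂ q₂) (a c : ℤ)
    (s : ℂ) : Prop :=
  (∃ γ ∈ CongruenceSubgroup.Gamma0 (q₁ * q₂), γ 0 0 = a ∧ γ 1 0 = c) ∧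
    ∀ γ ∈ CongruenceSubgroup.Gamma0 (q₁ * q₂), γ 0 0 = a → γ 1 0 = c →
      ∀ z : UpperHalfPlane, dedekindSumAt χ₁ χ₂ γ z = s

end NewformDedekind

end

namespace NewformDedekind

open Complex Filter Topology

/-! Up to right translation by an integer, which does not change `F`, the matrix `γ` is parabolic
with eigenvalue `ε` and fixes the cusp `r / q₂`. In the coordinate `t` with `z = r / q₂ - 1 / t` it
acts by `t ↦ t + h`, `h = -ε q₂ N k` (`exists_gamma_smul_eq`), and `ψ(γ) = 1`. So the Dedekind sum
is a nonzero multiple of `g (t + h) - g t` with `g t = F (r / q₂ - 1 / t)`.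

The derivative of `g` is a weight two Eisenstein series. The Lipschitz formula writes it as a
lattice sum over `1 / (n t - q₂ a) ^ 2` (`tsum_block_cuspWeight_eq`), where periodicity under `h`
and the limit at `i ∞` can be read off. The limit comes from the terms `n = 0` and is a nonzero
multiple of `L(2, χ₁ χ₂)` (`exists_hasSum_cuspWeight_zero`). Hence the increment of `g` is a nonzero
constant times `h` (`add_period_sub_eq`, `exists_cusp_period`).

Weight two series do not converge absolutely. The cure is to sum `a` over a full period first: since
`χ₁ ≠ 1` the weights cancel there, and the resulting blocks decay like `‖x‖ ^ (-3)`
(`norm_block_le`). -/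

/-! ### Gauss sums and the Lipschitz formula. -/

/-- The Gauss sum of a primitive Dirichlet character does not vanish. -/
lemma gaussSum_ne_zero_of_isPrimitive {q : ℕ} [NeZero q] {χ : DirichletCharacter ℂ q}
    (hχ : χ.IsPrimitive) : gaussSum χ ZMod.stdAddChar ≠ 0 := by
  intro h
  have h0 : ZMod.dft (χ : ZMod q → ℂ) = 0 := by
    ext k
    rw [hχ.fourierTransform_eq_inv_mul_gaussSum, h, mul_zero, Pi.zero_apply]
  have h1 : (χ : ZMod q → ℂ) = 0 := ZMod.dft.map_eq_zero_iff.mp h0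
  have h2 := congrFun h1 1
  simp at h2

lemma sum_fin_eq_sum_zmod {N : ℕ} [NeZero N] (f : ZMod N → ℂ) :
    ∑ j : Fin N, f ((j : ℕ) : ZMod N) = ∑ x : ZMod N, f x := by
  refine Fintype.sum_bijective (fun j : Fin N ↦ ((j : ℕ) : ZMod N)) ?_ _ _ fun _ ↦ rfl
  rw [Fintype.bijective_iff_injective_and_card]
  refine ⟨fun a b h ↦ Fin.ext ?_, by simp [ZMod.card]⟩
  have := congrArg ZMod.val h
  simpa [ZMod.val_natCast, Nat.mod_eq_of_lt a.2, Nat.mod_eq_of_lt b.2] using this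

lemma sum_fin_mul_exp_eq {q : ℕ} [NeZero q] {χ : DirichletCharacter ℂ q}
    (hχ : χ.IsPrimitive) (b : ℕ) :
    ∑ ν : Fin q, χ ((ν : ℕ) : ZMod q) * exp (2 * Real.pi * I * ((ν : ℕ) / q)) ^ b =
      χ⁻¹ (b : ZMod q) * gaussSum χ ZMod.stdAddChar := by
  rw [← gaussSum_mulShift_of_isPrimitive _ hχ, gaussSum, ← sum_fin_eq_sum_zmod]
  refine Finset.sum_congr rfl fun ν _ ↦ ?_
  rw [AddChar.mulShift_apply]
  have := ZMod.stdAddChar_coe (N := q) ((b : ℤ) * ((ν : ℕ) : ℤ))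
  push_cast at this
  rw [this, ← Complex.exp_nat_mul]
  congr 2
  ring

lemma summable_div_linear_sq {q : ℕ} (χ : DirichletCharacter ℂ q) (w : ℂ) :
    Summable fun m : ℤ ↦ χ (m : ZMod q) / (w + m) ^ 2 := by
  have h := (EisensteinSeries.linear_right_summable w 1 (k := 2) le_rfl).norm
  refine Summable.of_norm_bounded h fun m ↦ ?_
  rw [div_eq_mul_inv, norm_mul]
  refine (mul_le_of_le_one_left (norm_nonneg _) (χ.norm_le_one _)).trans (le_of_eq ?_)
  simp [zpow_ofNat]

/-- The twisted Lipschitz formula. -/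
lemma hasSum_lipschitz {q : ℕ} [NeZero q] {χ : DirichletCharacter ℂ q}
    (hχ : χ.IsPrimitive) {τ : ℂ} (hτ : 0 < τ.im) :
    HasSum (fun m : ℤ ↦ χ (m : ZMod q) / (q * τ + m) ^ 2)
      ((2 * Real.pi * I / q) ^ 2 * gaussSum χ ZMod.stdAddChar *
        ∑' b : ℕ+, χ⁻¹ (b : ZMod q) * (b : ℂ) * exp (2 * Real.pi * I * τ) ^ (b : ℕ)) := by
  have hq : (q : ℂ) ≠ 0 := NeZero.ne _
  have hs := summable_div_linear_sq χ (q * τ)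
  convert hs.hasSum using 1
  have him (ν : Fin q) : 0 < (τ + (ν : ℕ) / q : ℂ).im := by
    have : ((ν : ℕ) / q : ℂ) = (((ν : ℕ) / q : ℝ) : ℂ) := by push_cast; rfl
    rw [add_im, this, ofReal_im, add_zero]; exact hτ
  have hs' := (Int.divModEquiv q).symm.summable_iff.mpr hs
  -- The character is constant on the residue class of `ν` modulo `q`, so the classical Lipschitz
  -- formula applies at `τ + ν / q`.
  have key (ν : Fin q) : ∑' n : ℤ, χ (((Int.divModEquiv q).symm (n, ν) : ℤ) : ZMod q) /
      (q * τ + ((Int.divModEquiv q).symm (n, ν) : ℤ)) ^ 2 =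
      χ ((ν : ℕ) : ZMod q) * ((2 * Real.pi * I / q) ^ 2 *
        ∑' b : ℕ+, (b : ℂ) * exp (2 * Real.pi * I * (τ + (ν : ℕ) / q)) ^ (b : ℕ)) := by
    have hl := EisensteinSeries.qExpansion_identity_pnat le_rfl ⟨_, him ν⟩
    simp only [pow_one, Nat.factorial_one, Nat.cast_one, div_one, Nat.reduceAdd] at hl
    have : (2 * Real.pi * I / q) ^ 2 *
        ∑' b : ℕ+, (b : ℂ) * exp (2 * Real.pi * I * (τ + (ν : ℕ) / q)) ^ (b : ℕ) =
        (1 / q ^ 2) * ∑' n : ℤ, 1 / (τ + (ν : ℕ) / q + n) ^ 2 := by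
      rw [hl]; ring
    rw [this, ← tsum_mul_left, ← tsum_mul_left]
    refine tsum_congr fun n ↦ ?_
    rw [Int.divModEquiv_symm_apply]
    push_cast
    rw [ZMod.natCast_self, mul_zero, zero_add]
    rw [show (q * τ + (n * q + (ν : ℕ)) : ℂ) = q * (τ + (ν : ℕ) / q + n) by field_simp; ring,
      mul_pow]
    rw [← mul_assoc, mul_one_div, mul_one_div, div_div]
  have hsb (ν : Fin q) : Summable fun b : ℕ+ ↦ χ ((ν : ℕ) : ZMod q) *
      ((b : ℂ) * exp (2 * Real.pi * I * (τ + (ν : ℕ) / q)) ^ (b : ℕ)) := by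
    refine Summable.mul_left _ ?_
    have := summable_pow_mul_cexp 1 1 ⟨_, him ν⟩
    simp only [pow_one, PNat.one_coe, Nat.cast_one, mul_one] at this
    exact this.comp_injective PNat.coe_injective
  have hs'' : Summable fun c : Fin q × ℤ ↦
      χ (((Int.divModEquiv q).symm (Equiv.prodComm (Fin q) ℤ c) : ℤ) : ZMod q) /
        (q * τ + ((Int.divModEquiv q).symm (Equiv.prodComm (Fin q) ℤ c) : ℤ)) ^ 2 :=
    (Equiv.prodComm (Fin q) ℤ).summable_iff.mpr hs'
  rw [← (Int.divModEquiv q).symm.tsum_eq, ← (Equiv.prodComm (Fin q) ℤ).tsum_eq, hs''.tsum_prod,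
    tsum_fintype (β := Fin q)]
  simp only [Equiv.prodComm_apply, Prod.swap_prod_mk, key]
  simp_rw [mul_left_comm _ ((2 * Real.pi * I / q : ℂ) ^ 2), ← Finset.mul_sum,
    mul_assoc ((2 * Real.pi * I / q : ℂ) ^ 2)]
  congr 1
  simp_rw [← tsum_mul_left]
  rw [← Summable.tsum_finsetSum fun ν _ ↦ hsb ν]
  refine tsum_congr fun b ↦ ?_
  have := sum_fin_mul_exp_eq hχ b
  calc _ = (χ⁻¹ (b : ZMod q) * gaussSum χ ZMod.stdAddChar) *
        (b * exp (2 * Real.pi * I * τ) ^ (b : ℕ)) := by ring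
    _ = _ := by
      rw [← this, Finset.sum_mul]
      refine Finset.sum_congr rfl fun ν _ ↦ ?_
      rw [show (2 * Real.pi * I * (τ + (ν : ℕ) / q) : ℂ) =
        2 * Real.pi * I * τ + 2 * Real.pi * I * ((ν : ℕ) / q) by ring, Complex.exp_add, mul_pow]
      ring

/-! ### The `q`-expansion of `F` and its derivative. -/

section QSeries

variable {q₁ q₂ : ℕ} (χ₁ : DirichletCharacter ℂ q₁) (χ₂ : DirichletCharacter ℂ q₂)

/-- The terms of the `q`-expansion of `F`, indexed by factorizations `n = a b`. -/
noncomputable def qTerm (x : ℕ+ × ℕ+) (z : ℂ) : ℂ :=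
  χ₁ (x.1 : ZMod q₁) * χ₂⁻¹ (x.2 : ZMod q₂) / (x.1 : ℂ) *
    exp (2 * Real.pi * I * ((x.1 * x.2 : ℕ) : ℂ) * z)

/-- The derivative of `qTerm` divided by `2 π i`. -/
noncomputable def qTermDeriv (x : ℕ+ × ℕ+) (z : ℂ) : ℂ :=
  χ₁ (x.1 : ZMod q₁) * χ₂⁻¹ (x.2 : ZMod q₂) * (x.2 : ℂ) *
    exp (2 * Real.pi * I * ((x.1 * x.2 : ℕ) : ℂ) * z)

lemma norm_exp_two_pi_I_mul_le {y : ℝ} {z : ℂ} (hz : y ≤ z.im) (n : ℕ) :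
    ‖exp (2 * Real.pi * I * (n : ℂ) * z)‖ ≤ Real.exp (-(2 * Real.pi * y)) ^ n := by
  rw [Complex.norm_exp, ← Real.exp_nat_mul]
  have : (2 * Real.pi * I * (n : ℂ) * z).re = n * -(2 * Real.pi * z.im) := by
    simp [mul_re, mul_im]; ring
  rw [this]
  gcongr

lemma norm_character_mul_le_one (x : ℕ+ × ℕ+) :
    ‖χ₁ (x.1 : ZMod q₁) * χ₂⁻¹ (x.2 : ZMod q₂)‖ ≤ 1 := by
  rw [norm_mul]
  exact mul_le_one₀ (χ₁.norm_le_one _) (norm_nonneg _) (χ₂⁻¹.norm_le_one _)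

lemma norm_qTermDeriv_le {y : ℝ} {z : ℂ} (hz : y ≤ z.im) (x : ℕ+ × ℕ+) :
    ‖qTermDeriv χ₁ χ₂ x z‖ ≤ x.2 ^ 1 * Real.exp (-(2 * Real.pi * y)) ^ (x.1 * x.2 : ℕ) := by
  rw [qTermDeriv, norm_mul, norm_mul, pow_one]
  gcongr
  · refine (mul_le_of_le_one_left (norm_nonneg _) (norm_character_mul_le_one χ₁ χ₂ x)).trans ?_
    simp
  · exact norm_exp_two_pi_I_mul_le hz _

lemma norm_qTerm_le {y : ℝ} {z : ℂ} (hz : y ≤ z.im) (x : ℕ+ × ℕ+) :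
    ‖qTerm χ₁ χ₂ x z‖ ≤ x.2 ^ 0 * Real.exp (-(2 * Real.pi * y)) ^ (x.1 * x.2 : ℕ) := by
  rw [qTerm, norm_mul, norm_div, pow_zero]
  gcongr
  · refine div_le_one_of_le₀ ((norm_character_mul_le_one χ₁ χ₂ x).trans ?_) (norm_nonneg _)
    rw [Complex.norm_natCast]
    exact_mod_cast x.1.pos
  · exact norm_exp_two_pi_I_mul_le hz _

lemma summable_prod_exp_bound (k : ℕ) {y : ℝ} (hy : 0 < y) :
    Summable fun x : ℕ+ × ℕ+ ↦
      (x.2 : ℝ) ^ k * Real.exp (-(2 * Real.pi * y)) ^ (x.1 * x.2 : ℕ) := by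
  refine summable_prod_mul_pow k ?_
  rw [Real.norm_eq_abs, Real.abs_exp, Real.exp_lt_one_iff]
  have := Real.pi_pos
  nlinarith [mul_pos this hy]

lemma summable_qTerm {z : ℂ} (hz : 0 < z.im) : Summable fun x ↦ qTerm χ₁ χ₂ x z :=
  (summable_prod_exp_bound 0 hz).of_norm_bounded (norm_qTerm_le χ₁ χ₂ le_rfl)

lemma summable_qTermDeriv {z : ℂ} (hz : 0 < z.im) : Summable fun x ↦ qTermDeriv χ₁ χ₂ x z :=
  (summable_prod_exp_bound 1 hz).of_norm_bounded (norm_qTermDeriv_le χ₁ χ₂ le_rfl)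

lemma hasDerivAt_qTerm (x : ℕ+ × ℕ+) (z : ℂ) :
    HasDerivAt (qTerm χ₁ χ₂ x) (2 * Real.pi * I * qTermDeriv χ₁ χ₂ x z) z := by
  have h := (((hasDerivAt_id z).const_mul (2 * Real.pi * I * ((x.1 * x.2 : ℕ) : ℂ))).cexp).const_mul
    (χ₁ (x.1 : ZMod q₁) * χ₂⁻¹ (x.2 : ZMod q₂) / (x.1 : ℂ))
  refine h.congr_deriv ?_
  have : ((x.1 : ℕ) : ℂ) ≠ 0 := by simp
  rw [qTermDeriv]
  push_cast
  field_simp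
  rfl

lemma hasDerivAt_tsum_qTerm {z : ℂ} (hz : 0 < z.im) :
    HasDerivAt (fun w ↦ ∑' x, qTerm χ₁ χ₂ x w)
      (2 * Real.pi * I * ∑' x, qTermDeriv χ₁ χ₂ x z) z := by
  rw [← tsum_mul_left]
  have hz2 : z.im / 2 < z.im := by linarith
  refine hasDerivAt_tsum_of_isPreconnected (t := {w : ℂ | z.im / 2 < w.im}) (y₀ := z)
    ((summable_prod_exp_bound 1 (half_pos hz)).mul_left (2 * Real.pi))
    (isOpen_lt continuous_const continuous_im)
    (convex_halfSpace_im_gt _).isPreconnected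
    (fun x w _ ↦ hasDerivAt_qTerm χ₁ χ₂ x w) (fun x w hw ↦ ?_) hz2 (summable_qTerm χ₁ χ₂ hz) hz2
  rw [norm_mul]
  refine mul_le_mul (le_of_eq ?_) (norm_qTermDeriv_le χ₁ χ₂ (le_of_lt hw) x) (norm_nonneg _)
    (by positivity)
  simp [abs_of_pos Real.pi_pos]

lemma hasSum_qTermDeriv_fiberwise {z : ℂ} (hz : 0 < z.im) :
    HasSum (fun a : ℕ+ ↦ χ₁ (a : ZMod q₁) * ∑' b : ℕ+, χ₂⁻¹ (b : ZMod q₂) * (b : ℂ) *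
      exp (2 * Real.pi * I * (a * z)) ^ (b : ℕ)) (∑' x, qTermDeriv χ₁ χ₂ x z) := by
  have hs := summable_qTermDeriv χ₁ χ₂ hz
  refine hs.hasSum.prod_fiberwise fun a ↦ ?_
  have h : (fun b : ℕ+ ↦ qTermDeriv χ₁ χ₂ (a, b) z) = fun b : ℕ+ ↦ χ₁ (a : ZMod q₁) *
      (χ₂⁻¹ (b : ZMod q₂) * (b : ℂ) * exp (2 * Real.pi * I * (a * z)) ^ (b : ℕ)) := by
    ext b
    rw [qTermDeriv, ← Complex.exp_nat_mul]
    push_cast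
    rw [show (2 * Real.pi * I * (a * b) * z : ℂ) = b * (2 * Real.pi * I * (a * z)) by ring]
    ring
  rw [← tsum_mul_left, ← h]
  exact (hs.prod_factor a).hasSum

variable {χ₁ χ₂} in
-- At `s = 1`, `√(b / a) / √(a b) = 1 / a`.
lemma lam_one_div_sqrt (n : ℕ+) :
    lam χ₁ χ₂ n 1 / (Real.sqrt ((n : ℕ) : ℝ) : ℂ) =
      ∑ p ∈ (n : ℕ).divisorsAntidiagonal,
        χ₁ (p.1 : ZMod q₁) * χ₂⁻¹ (p.2 : ZMod q₂) / (p.1 : ℂ) := by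
  rw [lam, Finset.sum_div]
  refine Finset.sum_congr rfl fun p hp ↦ ?_
  obtain ⟨hp1, hp2⟩ := Nat.mem_divisorsAntidiagonal.mp hp
  have h1 : 0 < (p.1 : ℝ) := by
    rcases Nat.eq_zero_or_pos p.1 with h | h
    · simp [h] at hp1; omega
    · exact_mod_cast h
  have h2 : 0 < (p.2 : ℝ) := by
    rcases Nat.eq_zero_or_pos p.2 with h | h
    · simp [h] at hp1; omega
    · exact_mod_cast h
  have key : ((p.2 : ℂ) / (p.1 : ℂ)) ^ ((1 : ℂ) - 1 / 2) / (Real.sqrt ((n : ℕ) : ℝ) : ℂ) =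
      1 / (p.1 : ℂ) := by
    have e1 : ((p.2 : ℂ) / (p.1 : ℂ)) ^ ((1 : ℂ) - 1 / 2) =
        ((Real.sqrt ((p.2 : ℝ) / p.1) : ℝ) : ℂ) := by
      rw [Real.sqrt_eq_rpow, Complex.ofReal_cpow (by positivity)]
      push_cast
      norm_num
    rw [e1, ← hp1, Nat.cast_mul, ← Complex.ofReal_div, Real.sqrt_div h2.le,
      Real.sqrt_mul h1.le]
    have s1 := Real.mul_self_sqrt h1.le
    have p1 := Real.sqrt_pos.mpr h1
    have p2 := Real.sqrt_pos.mpr h2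
    have : √(p.2 : ℝ) / √(p.1 : ℝ) / (√(p.1 : ℝ) * √(p.2 : ℝ)) = 1 / (p.1 : ℝ) := by
      field_simp
      rw [sq, s1]
    rw [this]; push_cast; rfl
  rw [mul_div_assoc, key, mul_one_div]

lemma F_eq_tsum_qTerm [NeZero q₁] [NeZero q₂] (hq₁ : q₁ ≠ 1) (z : UpperHalfPlane) :
    F χ₁ χ₂ z = cZero χ₁ q₂ + ∑' x, qTerm χ₁ χ₂ x z := by
  rw [F, cOne, if_neg hq₁, zero_mul, zero_add]
  congr 1
  have hs := summable_qTerm χ₁ χ₂ z.2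
  have hs' : Summable fun c ↦ qTerm χ₁ χ₂ (sigmaAntidiagonalEquivProd c) z :=
    sigmaAntidiagonalEquivProd.summable_iff.mpr hs
  rw [← sigmaAntidiagonalEquivProd.tsum_eq, hs'.tsum_sigma]
  refine tsum_congr fun n ↦ ?_
  rw [lam_one_div_sqrt, tsum_fintype, Finset.sum_mul, ← Finset.sum_attach, Finset.univ_eq_attach]
  refine Finset.sum_congr rfl fun p _ ↦ ?_
  have h := (Nat.mem_divisorsAntidiagonal.mp p.2).1
  simp only [qTerm, sigmaAntidiagonalEquivProd, divisorsAntidiagonalFactors, Equiv.coe_fn_mk,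
    PNat.mk_coe, h]

end QSeries

/-! ### Lattice sums of weight two, grouped in blocks. -/

lemma summable_prod_int_norm_rpow {k : ℝ} (hk : 2 < k) :
    Summable fun x : ℤ × ℤ ↦ ‖x‖ ^ (-k) := by
  refine ((finTwoArrowEquiv ℤ).symm.summable_iff.mpr
    (EisensteinSeries.summable_one_div_norm_rpow hk)).congr fun x ↦ ?_
  have : ‖(![x.1, x.2] : Fin 2 → ℤ)‖ = ‖x‖ := by
    rw [EisensteinSeries.norm_eq_max_natAbs, Prod.norm_def, Int.norm_eq_abs, Int.norm_eq_abs]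
    simp [Nat.cast_natAbs]
  simp [this]

lemma hasSum_int_sum_fin {N : ℕ} [NeZero N] {p : ℤ → ℂ} {S : ℂ} (hp : HasSum p S) :
    HasSum (fun l : ℤ ↦ ∑ j : Fin N, p (l * N + (j : ℕ))) S :=
  ((Int.divModEquiv N).symm.hasSum_iff.mpr hp).prod_fiberwise fun _ ↦ hasSum_fintype _

lemma hasSum_int_of_even {p : ℤ → ℂ} (hp : ∀ a, p (-a) = p a) (h0 : p 0 = 0) {S : ℂ}
    (h : HasSum (fun a : ℕ+ ↦ p (a : ℕ)) S) : HasSum p (2 * S) := by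
  have h1 : HasSum (fun a : ℕ ↦ p (a + 1 : ℕ)) S :=
    (Equiv.pnatEquivNat.symm.hasSum_iff (f := fun a : ℕ+ ↦ p (a : ℕ))).mpr h
  have h2 : HasSum (fun a : ℕ ↦ p a) S := by
    rw [← hasSum_nat_add_iff' 1]
    simpa [h0] using h1
  rw [two_mul]
  refine h2.of_nat_of_neg_add_one ?_
  simp only [hp]
  exact_mod_cast h1

lemma abs_le_abs_mul_add {N : ℕ} (l : ℤ) (j : Fin N) : |l| ≤ |l * N + (j : ℕ)| := by
  have h1 : (1 : ℤ) ≤ N := by have := j.2; omega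
  have h2 : ((j : ℕ) : ℤ) + 1 ≤ N := by have := j.2; omega
  rcases le_or_gt 0 l with h | h
  · rw [abs_of_nonneg h, abs_of_nonneg (by positivity)]
    nlinarith
  · rw [abs_of_neg h, le_abs]
    right
    nlinarith

/-- The sum over one period of the terms of a twisted weight two Eisenstein series. -/
noncomputable def block (W : ℤ → ℤ → ℂ) (N s : ℕ) (t : ℂ) (x : ℤ × ℤ) : ℂ :=
  ∑ j : Fin N, W x.1 (j : ℕ) / (x.1 * t - s * (x.2 * N + (j : ℕ))) ^ 2

/-- The denominator is `c z + d` with integers `c`, `d` at least as large in absolute value as the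
two block coordinates, so the standard Eisenstein bound holds uniformly in `j`. -/
lemma r_mul_norm_le {N s : ℕ} (hs : s ≠ 0) (z : UpperHalfPlane) {x : ℤ × ℤ} (hx : x ≠ 0)
    (j : Fin N) :
    EisensteinSeries.r z * ‖x‖ ≤ ‖(x.1 * z - s * (x.2 * N + (j : ℕ)) : ℂ)‖ := by
  set v : Fin 2 → ℤ := ![x.1, -(s * (x.2 * N + (j : ℕ)))] with hv
  have hnorm : ‖x‖ ≤ ‖v‖ := by
    rw [Prod.norm_def]
    refine max_le (norm_le_pi_norm v 0) (le_trans ?_ (norm_le_pi_norm v 1))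
    simp only [hv, Matrix.cons_val_one, Matrix.cons_val_fin_one, norm_neg, Int.norm_eq_abs]
    have h := abs_le_abs_mul_add x.2 j
    have h1 : (1 : ℤ) ≤ s := by omega
    have : |x.2| ≤ |(s * (x.2 * N + (j : ℕ)) : ℤ)| := by
      rw [abs_mul, Nat.abs_cast]
      nlinarith [abs_nonneg (x.2 * N + (j : ℕ))]
    exact_mod_cast this
  have hv0 : v ≠ 0 := by
    rw [← norm_pos_iff]
    exact (norm_pos_iff.mpr hx).trans_le hnorm
  refine (mul_le_mul_of_nonneg_left hnorm (EisensteinSeries.r_pos z).le).trans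
    ((EisensteinSeries.r_mul_max_le z hv0).trans (le_of_eq ?_))
  congr 1
  simp [hv]
  ring

lemma norm_inv_sq_sub_inv_sq_le {a b : ℂ} {R : ℝ} (hR : 0 < R) (ha : R ≤ ‖a‖) (hb : R ≤ ‖b‖) :
    ‖1 / a ^ 2 - 1 / b ^ 2‖ ≤ 2 * ‖b - a‖ / R ^ 3 := by
  have ha0 : a ≠ 0 := norm_pos_iff.mp (hR.trans_le ha)
  have hb0 : b ≠ 0 := norm_pos_iff.mp (hR.trans_le hb)
  have h : 1 / a ^ 2 - 1 / b ^ 2 = (b - a) * (1 / (b * a ^ 2) + 1 / (b ^ 2 * a)) := by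
    field_simp; ring
  have h1 : ‖1 / (b * a ^ 2)‖ ≤ 1 / R ^ 3 := by
    rw [norm_div, norm_one, norm_mul, norm_pow, show R ^ 3 = R * R ^ 2 by ring]
    gcongr
  have h2 : ‖1 / (b ^ 2 * a)‖ ≤ 1 / R ^ 3 := by
    rw [norm_div, norm_one, norm_mul, norm_pow, show R ^ 3 = R ^ 2 * R by ring]
    gcongr
  rw [h, norm_mul]
  calc _ ≤ ‖b - a‖ * (1 / R ^ 3 + 1 / R ^ 3) := by
        gcongr; exact (norm_add_le _ _).trans (add_le_add h1 h2)
    _ = _ := by ring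

section Block

variable {W : ℤ → ℤ → ℂ} {N s : ℕ} [NeZero N] (hs : s ≠ 0) (hW : ∀ n a, ‖W n a‖ ≤ 1)
  (hsum : ∀ n, ∑ j : Fin N, W n (j : ℕ) = 0)

include hs hW hsum in
-- The weights sum to zero over a period, so the common value `1 / A ^ 2` can be subtracted from
-- every term; a difference of two inverse squares gains one power of decay.
lemma norm_block_le (z : UpperHalfPlane) {x : ℤ × ℤ} (hx : x ≠ 0) :
    ‖block W N s z x‖ ≤
      2 * s * N ^ 2 * (EisensteinSeries.r z ^ (-3 : ℝ) * ‖x‖ ^ (-3 : ℝ)) := by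
  set A : ℂ := x.1 * z - s * (x.2 * N) with hA
  set B : Fin N → ℂ := fun j ↦ x.1 * z - s * (x.2 * N + (j : ℕ)) with hB
  set R := EisensteinSeries.r z * ‖x‖ with hR
  have hR0 : 0 < R := mul_pos (EisensteinSeries.r_pos z) (norm_pos_iff.mpr hx)
  have hBR (j) : R ≤ ‖B j‖ := r_mul_norm_le hs z hx j
  have hAR : R ≤ ‖A‖ := by
    simpa [hB, hA] using hBR ⟨0, Nat.pos_of_ne_zero (NeZero.ne N)⟩
  have h1 : block W N s z x = ∑ j : Fin N, W x.1 (j : ℕ) * (1 / B j ^ 2 - 1 / A ^ 2) := by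
    simp_rw [mul_sub, Finset.sum_sub_distrib, ← Finset.sum_mul, hsum, zero_mul, sub_zero,
      mul_one_div]
    rfl
  have h2 (j : Fin N) : ‖W x.1 (j : ℕ) * (1 / B j ^ 2 - 1 / A ^ 2)‖ ≤ 2 * (s * N) / R ^ 3 := by
    rw [norm_mul]
    refine (mul_le_of_le_one_left (norm_nonneg _) (hW _ _)).trans
      ((norm_inv_sq_sub_inv_sq_le hR0 (hBR j) hAR).trans ?_)
    gcongr
    have : A - B j = ((s * (j : ℕ) : ℕ) : ℂ) := by rw [hA, hB]; push_cast; ring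
    rw [this, Complex.norm_natCast]
    exact_mod_cast Nat.mul_le_mul_left s j.2.le
  rw [h1]
  refine (norm_sum_le_of_le _ fun j _ ↦ h2 j).trans (le_of_eq ?_)
  rw [Finset.sum_const, Finset.card_univ, Fintype.card_fin, nsmul_eq_mul,
    ← Real.mul_rpow (EisensteinSeries.r_pos z).le (norm_nonneg _), ← hR, Real.rpow_neg hR0.le]
  norm_cast
  push_cast
  field_simp

include hs hW hsum in
lemma exists_summable_bound_block (A : ℝ) {B : ℝ} (hB : 0 < B) :
    ∃ u : ℤ × ℤ → ℝ, Summable u ∧ ∀ z ∈ UpperHalfPlane.verticalStrip A B, ∀ x,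
      ‖block W N s z x‖ ≤ u x := by
  set ρ := EisensteinSeries.r ⟨⟨A, B⟩, hB⟩ with hρ
  -- The block at the origin escapes the cubic bound, but it does not depend on `z`.
  refine ⟨fun x ↦ 2 * s * N ^ 2 * (ρ ^ (-3 : ℝ) * ‖x‖ ^ (-3 : ℝ)) +
    if x = 0 then ‖block W N s 0 0‖ else 0, ?_, fun z hz x ↦ ?_⟩
  · refine Summable.add (((summable_prod_int_norm_rpow (by norm_num)).mul_left _).mul_left _) ?_
    exact (hasSum_ite_eq (0 : ℤ × ℤ) ‖block W N s 0 0‖).summable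
  · by_cases hx : x = 0
    · subst hx
      simp only [if_true]
      refine le_trans (le_of_eq ?_) (le_add_of_nonneg_left ?_)
      · simp [block]
      · have := (EisensteinSeries.r_pos ⟨⟨A, B⟩, hB⟩).le
        positivity
    · simp only [hx, if_false, add_zero]
      refine (norm_block_le hs hW hsum z hx).trans ?_
      gcongr ?_ * (?_ * _)
      exact Real.rpow_le_rpow_of_nonpos (EisensteinSeries.r_pos _)
        (EisensteinSeries.r_lower_bound_on_verticalStrip z hB hz) (by norm_num)

include hs hW hsum in
lemma summable_block (z : UpperHalfPlane) : Summable (block W N s z) := by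
  obtain ⟨u, hu, h⟩ := exists_summable_bound_block hs hW hsum |z.re| z.im_pos
  exact hu.of_norm_bounded (h z ⟨le_rfl, le_rfl⟩)

include hs hW hsum in
-- Absolute summability of the blocks justifies interchanging the sums over `n` and over `a`.
lemma tsum_block_eq {z : UpperHalfPlane} (hper : ∀ n a l : ℤ, W n (l * N + a) = W n a)
    {p : ℤ → ℂ} {S : ℂ}
    (hp : ∀ a : ℤ, HasSum (fun n : ℤ ↦ W n a / (n * (z : ℂ) - s * a) ^ 2) (p a))
    (hS : HasSum p S) : ∑' x, block W N s z x = S := by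
  have h := (Equiv.prodComm ℤ ℤ).hasSum_iff.mpr (summable_block hs hW hsum z).hasSum
  refine (h.prod_fiberwise fun l ↦ ?_).unique (hasSum_int_sum_fin (N := N) hS)
  refine (hasSum_sum fun j _ ↦ hp (l * N + (j : Fin N))).congr_fun fun n ↦ ?_
  simp [block, hper]

omit [NeZero N] in
-- The shear `(n, l) ↦ (n, l - n k)` absorbs the translation, and the weights do not involve `l`.
lemma tsum_block_add (t : ℂ) (k : ℤ) :
    ∑' x, block W N s (t + s * N * k) x = ∑' x, block W N s t x := by
  let e : ℤ × ℤ ≃ ℤ × ℤ :=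
    { toFun := fun x ↦ (x.1, x.2 - x.1 * k)
      invFun := fun x ↦ (x.1, x.2 + x.1 * k)
      left_inv := fun x ↦ by simp
      right_inv := fun x ↦ by simp }
  rw [← e.tsum_eq (block W N s t)]
  refine tsum_congr fun x ↦ Finset.sum_congr rfl fun j _ ↦ ?_
  simp only [e, Equiv.coe_fn_mk]
  push_cast
  ring_nf

omit [NeZero N] in
lemma tendsto_block {x : ℤ × ℤ} (hx : x.1 ≠ 0) :
    Tendsto (fun z : UpperHalfPlane ↦ block W N s z x) (comap UpperHalfPlane.im atTop) (𝓝 0) := by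
  rw [← Finset.sum_const_zero (s := (Finset.univ : Finset (Fin N)))]
  refine tendsto_finsetSum _ fun j _ ↦ ?_
  have h : Tendsto (fun z : UpperHalfPlane ↦ (x.1 * z - s * (x.2 * N + (j : ℕ)) : ℂ))
      (comap UpperHalfPlane.im atTop) (Bornology.cobounded ℂ) := by
    rw [← tendsto_norm_atTop_iff_cobounded]
    refine tendsto_atTop_mono (fun z ↦ abs_im_le_norm _) ?_
    have h1 (z : UpperHalfPlane) :
        |(x.1 * z - s * (x.2 * N + (j : ℕ)) : ℂ).im| = |(x.1 : ℝ)| * z.im := by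
      rw [← abs_of_pos z.im_pos, ← abs_mul]
      simp
    simp_rw [h1]
    exact tendsto_comap.const_mul_atTop (abs_pos.mpr (Int.cast_ne_zero.mpr hx))
  have h2 := ((tendsto_inv₀_cobounded.comp h).pow 2).const_mul (W x.1 (j : ℕ))
  simpa [div_eq_mul_inv] using h2

include hs hW hsum in
-- By dominated convergence in a strip only the row `n = 0`, which is constant in `z`, survives.
lemma tendsto_tsum_block (A : ℝ) {C : ℂ} (hper : ∀ n a l : ℤ, W n (l * N + a) = W n a)
    (hC : HasSum (fun a : ℤ ↦ W 0 a / (s * a : ℂ) ^ 2) C) :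
    Tendsto (fun z : UpperHalfPlane ↦ ∑' x, block W N s z x)
      (comap UpperHalfPlane.im atTop ⊓ 𝓟 (UpperHalfPlane.verticalStrip A 1)) (𝓝 C) := by
  obtain ⟨u, hu, hb⟩ := exists_summable_bound_block hs hW hsum A one_pos
  have hCe : C = ∑' x : ℤ × ℤ, if x.1 = 0 then block W N s 0 x else 0 := by
    have hinj : Function.Injective (fun l : ℤ ↦ ((0, l) : ℤ × ℤ)) :=
      fun a b h ↦ (Prod.ext_iff.mp h).2
    rw [← hinj.tsum_eq, ← (hasSum_int_sum_fin (N := N) hC).tsum_eq]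
    · refine tsum_congr fun l ↦ ?_
      simp [block, hper]
    · intro x hx
      rcases x with ⟨n, l⟩
      by_cases h : n = 0
      · exact ⟨l, by simp [h]⟩
      · simp [h] at hx
  rw [hCe]
  refine tendsto_tsum_of_dominated_convergence hu (fun x ↦ ?_) ?_
  · by_cases hx : x.1 = 0
    · simpa [block, hx] using tendsto_const_nhds
    · simpa [hx] using (tendsto_block hx).mono_left inf_le_left
  · exact eventually_inf_principal.mpr (Eventually.of_forall hb)

end Block

/-! ### Increment of a function with periodic derivative. -/

/-- If the derivative of `g` on the upper half plane has the real period `h` and tends to `C` at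
`i ∞`, uniformly in vertical strips, then `g (t + h) - g t = C h`. -/
lemma add_period_sub_eq {g E : ℂ → ℂ} {C : ℂ} {h : ℝ}
    (hg : ∀ t : ℂ, 0 < t.im → HasDerivAt g (E t) t)
    (hper : ∀ t : ℂ, 0 < t.im → E (t + h) = E t)
    (hlim : ∀ A, Tendsto (fun z : UpperHalfPlane ↦ E z)
      (comap UpperHalfPlane.im atTop ⊓ 𝓟 (UpperHalfPlane.verticalStrip A 1)) (𝓝 C))
    {t : ℂ} (ht : 0 < t.im) : g (t + h) - g t = C * h := by
  have hd (w : ℂ) (hw : 0 < w.im) : HasDerivAt (fun w ↦ g (w + h) - g w) 0 w := by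
    have h1 : HasDerivAt (fun w ↦ g (w + h)) (E (w + h)) w :=
      (hg (w + h) (by simpa using hw)).comp_add_const w (h : ℂ)
    exact (h1.sub (hg w hw)).congr_deriv (by rw [hper w hw, sub_self])
  have hconst (w : ℂ) (hw : 0 < w.im) : g (w + h) - g w = g (t + h) - g t :=
    (isOpen_lt continuous_const continuous_im).is_const_of_deriv_eq_zero
      (convex_halfSpace_im_gt 0).isPreconnected
      (fun w hw ↦ (hd w hw).differentiableAt.differentiableWithinAt)
      (fun w hw ↦ (hd w hw).deriv) hw ht
  rw [← sub_eq_zero, ← norm_le_zero_iff]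
  -- The increment does not depend on the base point, so it is taken at a height where `E` is within
  -- `ε` of `C`; the mean value inequality for `g w - C w` then applies.
  have hbound (ε : ℝ) (hε : 0 < ε) : ‖g (t + h) - g t - C * h‖ ≤ ε * |h| := by
    have h1 := Metric.tendsto_nhds.mp (hlim |h|) ε hε
    rw [eventually_inf_principal, eventually_comap] at h1
    obtain ⟨Y, hY⟩ := eventually_atTop.mp h1
    set Z := max Y 1 with hZ
    have hZ1 : 1 ≤ Z := le_max_right _ _
    have hconv : Convex ℝ {w : ℂ | |w.re| ≤ |h| ∧ Z ≤ w.im} := by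
      have : {w : ℂ | |w.re| ≤ |h| ∧ Z ≤ w.im} =
          {w : ℂ | w.re ≤ |h|} ∩ {w : ℂ | -|h| ≤ w.re} ∩ {w : ℂ | Z ≤ w.im} := by
        ext w; simp only [Set.mem_ofPred_eq, Set.mem_inter_iff, abs_le]; tauto
      rw [this]
      exact ((convex_halfSpace_re_le _).inter (convex_halfSpace_re_ge _)).inter
        (convex_halfSpace_im_ge _)
    have hmv := Convex.norm_image_sub_le_of_norm_hasDerivWithin_le (f := fun w ↦ g w - C * w)
      (f' := fun w ↦ E w - C) (C := ε) (x := (Z : ℂ) * I) (y := (Z : ℂ) * I + h)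
      (s := {w : ℂ | |w.re| ≤ |h| ∧ Z ≤ w.im})
      (fun w hw ↦ by
        have hw0 : 0 < w.im := by linarith [hw.2]
        exact ((hg w hw0).sub ((hasDerivAt_id w).const_mul C)).hasDerivWithinAt.congr_deriv
          (by rw [mul_one]))
      (fun w hw ↦ by
        have hw0 : 0 < w.im := by linarith [hw.2]
        have := hY w.im ((le_max_left _ _).trans hw.2) ⟨w, hw0⟩ rfl
          ⟨hw.1, hZ1.trans hw.2⟩
        exact (dist_eq_norm (E w) C ▸ this).le)
      hconv (by simp) (by simp)
    rw [← hconst (Z * I) (by simpa using by linarith)]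
    refine le_trans (le_of_eq ?_) (hmv.trans (le_of_eq ?_))
    · congr 1; ring
    · simp
  have hlim0 : Tendsto (fun ε : ℝ ↦ ε * |h|) (𝓝[>] 0) (𝓝 (0 * |h|)) :=
    (tendsto_id.mono_left nhdsWithin_le_nhds).mul_const _
  rw [zero_mul] at hlim0
  exact ge_of_tendsto hlim0 (eventually_nhdsWithin_of_forall hbound)

/-! ### The weights attached to the cusp `r / q₂`. -/

section Characters

variable {q₁ q₂ : ℕ} (χ₁ : DirichletCharacter ℂ q₁)
  (χ₂ : DirichletCharacter ℂ q₂) (r : ℤ)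

/-- The coefficients of the Eisenstein series expanded at the cusp `r / q₂`. -/
noncomputable def cuspWeight (n a : ℤ) : ℂ := χ₁ (a : ZMod q₁) * χ₂ ((n - a * r : ℤ) : ZMod q₂)

lemma norm_cuspWeight_le (n a : ℤ) : ‖cuspWeight χ₁ χ₂ r n a‖ ≤ 1 := by
  rw [cuspWeight, norm_mul]
  exact mul_le_one₀ (χ₁.norm_le_one _) (norm_nonneg _) (χ₂.norm_le_one _)

lemma cuspWeight_add (n a l : ℤ) :
    cuspWeight χ₁ χ₂ r n (l * (q₁ * q₂ : ℕ) + a) = cuspWeight χ₁ χ₂ r n a := by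
  simp [cuspWeight]

variable {χ₁ χ₂} in
lemma cuspWeight_neg (hpar : χ₁ (-1) * χ₂ (-1) = 1) (n a : ℤ) :
    cuspWeight χ₁ χ₂ r (-n) (-a) = cuspWeight χ₁ χ₂ r n a := by
  have h1 : ((-a : ℤ) : ZMod q₁) = -1 * (a : ZMod q₁) := by push_cast; ring
  have h2 : ((-n - -a * r : ℤ) : ZMod q₂) = -1 * ((n - a * r : ℤ) : ZMod q₂) := by
    push_cast; ring
  rw [cuspWeight, h1, h2, map_mul, map_mul, cuspWeight]
  linear_combination (χ₁ (a : ZMod q₁) * χ₂ ((n - a * r : ℤ) : ZMod q₂)) * hpar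

lemma cuspWeight_zero_right (hq₁ : q₁ ≠ 1) (n : ℤ) : cuspWeight χ₁ χ₂ r n 0 = 0 := by
  have : Nontrivial (ZMod q₁) := ZMod.nontrivial_iff.mpr hq₁
  rw [cuspWeight, Int.cast_zero, MulChar.map_zero, zero_mul]

lemma ne_one_of_isPrimitive {q : ℕ} [NeZero q] {χ : DirichletCharacter ℂ q} (hχ : χ.IsPrimitive)
    (hq : q ≠ 1) : χ ≠ 1 := by
  rintro rfl
  rw [DirichletCharacter.isPrimitive_def, DirichletCharacter.conductor_one] at hχ
  exact hq hχ.symm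

variable {χ₁} in
-- By the Chinese remainder theorem the sum factors, and one factor is the full sum of `χ₁`.
lemma sum_cuspWeight [NeZero q₁] [NeZero q₂] (hcop : q₁.Coprime q₂) (h1 : χ₁ ≠ 1) (n : ℤ) :
    ∑ j : Fin (q₁ * q₂), cuspWeight χ₁ χ₂ r n (j : ℕ) = 0 := by
  have h := sum_fin_eq_sum_zmod (N := q₁ * q₂)
    (fun x ↦ χ₁ (ZMod.chineseRemainder hcop x).1 *
      χ₂ (n - (ZMod.chineseRemainder hcop x).2 * r))
  have h2 := Equiv.sum_comp (ZMod.chineseRemainder hcop).toEquiv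
    (fun y : ZMod q₁ × ZMod q₂ ↦ χ₁ y.1 * χ₂ (n - y.2 * r))
  simp only [RingEquiv.toEquiv_eq_coe, RingEquiv.coe_toEquiv] at h2
  rw [h2, Fintype.sum_prod_type] at h
  dsimp only at h
  rw [← Finset.sum_mul_sum, MulChar.sum_eq_zero_of_ne_one h1,
    zero_mul] at h
  rw [← h]
  refine Finset.sum_congr rfl fun j _ ↦ ?_
  simp [cuspWeight]

/-- The sum is `L(2, χ₁ χ₂)`, which lies in the half plane where Dirichlet `L`-series do not vanish.
-/
lemma exists_hasSum_mul_div_sq [NeZero q₁] [NeZero q₂] :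
    ∃ L : ℂ, L ≠ 0 ∧ HasSum (fun a : ℕ+ ↦ χ₁ (a : ZMod q₁) * χ₂ (a : ZMod q₂) / (a : ℂ) ^ 2) L := by
  set χ : DirichletCharacter ℂ (q₁ * q₂) :=
    DirichletCharacter.changeLevel (Nat.dvd_mul_right q₁ q₂) χ₁ *
      DirichletCharacter.changeLevel (Nat.dvd_mul_left q₂ q₁) χ₂ with hχ
  have h2 : 1 < (2 : ℂ).re := by norm_num
  refine ⟨_, χ.LSeries_ne_zero_of_one_lt_re h2, ?_⟩
  have h := (ZMod.LSeriesSummable_of_one_lt_re χ h2).hasSum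
  have h0 : Function.support (LSeries.term (fun n ↦ χ n) 2) ⊆
      Set.range (fun a : ℕ+ ↦ (a : ℕ)) := by
    intro n hn
    have : n ≠ 0 := by rintro rfl; simp at hn
    exact ⟨⟨n, Nat.pos_of_ne_zero this⟩, rfl⟩
  rw [← Function.Injective.hasSum_iff PNat.coe_injective
    (fun n hn ↦ Function.notMem_support.mp fun h ↦ hn (h0 h))] at h
  refine h.congr_fun fun a ↦ ?_
  rw [Function.comp_apply, LSeries.term_of_ne_zero a.ne_zero]
  norm_cast
  congr 1
  by_cases hu : IsUnit ((a : ℕ) : ZMod (q₁ * q₂))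
  · have e1 := DirichletCharacter.changeLevel_eq_cast_of_dvd χ₁ (Nat.dvd_mul_right q₁ q₂) hu.unit
    have e2 := DirichletCharacter.changeLevel_eq_cast_of_dvd χ₂ (Nat.dvd_mul_left q₂ q₁) hu.unit
    simp only [IsUnit.unit_spec] at e1 e2
    rw [hχ, MulChar.mul_apply, e1, e2, ZMod.cast_natCast (Nat.dvd_mul_right q₁ q₂),
      ZMod.cast_natCast (Nat.dvd_mul_left q₂ q₁)]
  · rw [MulChar.map_nonunit _ hu]
    rw [ZMod.isUnit_iff_coprime, Nat.coprime_mul_iff_right, not_and_or] at hu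
    rcases hu with hu | hu
    · rw [MulChar.map_nonunit χ₁ (by rwa [ZMod.isUnit_iff_coprime]), zero_mul]
    · rw [MulChar.map_nonunit χ₂ (by rwa [ZMod.isUnit_iff_coprime]), mul_zero]

variable {χ₁ χ₂ r} in
-- The weight at `n = 0` is `χ₂(-r) χ₁(a) χ₂(a)`, with `χ₂(-r) ≠ 0` by coprimality; parity makes
-- negative `a` double the sum instead of cancelling it.
lemma exists_hasSum_cuspWeight_zero [NeZero q₁] [NeZero q₂] (hpar : χ₁ (-1) * χ₂ (-1) = 1)
    (hr : IsCoprime r (q₂ : ℤ)) :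
    ∃ C : ℂ, C ≠ 0 ∧ HasSum (fun a : ℤ ↦ cuspWeight χ₁ χ₂ r 0 a / (q₂ * a : ℂ) ^ 2) C := by
  obtain ⟨L, hL, h⟩ := exists_hasSum_mul_div_sq χ₁ χ₂
  have hq₂ : (q₂ : ℂ) ≠ 0 := NeZero.ne _
  have hχr : χ₂ ((-r : ℤ) : ZMod q₂) ≠ 0 := by
    have : IsUnit ((-r : ℤ) : ZMod q₂) := by
      rw [ZMod.coe_int_isUnit_iff_isCoprime]
      exact hr.symm.neg_right
    exact (this.map χ₂).ne_zero
  refine ⟨2 * (χ₂ ((-r : ℤ) : ZMod q₂) / q₂ ^ 2 * L), ?_, ?_⟩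
  · exact mul_ne_zero two_ne_zero (mul_ne_zero (div_ne_zero hχr (pow_ne_zero 2 hq₂)) hL)
  refine hasSum_int_of_even (fun a ↦ ?_) ?_ ?_
  · have := cuspWeight_neg r hpar 0 a
    rw [neg_zero] at this
    rw [this]; push_cast; ring
  · simp
  · refine (h.mul_left _).congr_fun fun a ↦ ?_
    have : ((0 - (a : ℕ) * r : ℤ) : ZMod q₂) = ((-r : ℤ) : ZMod q₂) * ((a : ℕ) : ZMod q₂) := by
      push_cast; ring
    rw [cuspWeight, this, map_mul]
    push_cast
    field_simp

end Characters

/-! ### Behaviour of `F` and of `γ` at the cusp `r / q₂`. -/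

section Cusp

variable {q₁ q₂ : ℕ} [NeZero q₁] [NeZero q₂] {χ₁ : DirichletCharacter ℂ q₁}
  {χ₂ : DirichletCharacter ℂ q₂} {r : ℤ}

lemma sub_inv_im_pos (r : ℤ) (q : ℕ) {t : ℂ} (ht : 0 < t.im) : 0 < ((r : ℂ) / q - 1 / t).im := by
  have h0 : t ≠ 0 := by rintro rfl; simp at ht
  have : ((r : ℂ) / q) = ((r / q : ℝ) : ℂ) := by push_cast; rfl
  rw [this, sub_im, ofReal_im, one_div, inv_im, zero_sub, neg_div, neg_neg]
  exact div_pos ht (normSq_pos.mpr h0)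

omit [NeZero q₁] [NeZero q₂] in
lemma summable_cuspWeight_div_sq (χ₁ : DirichletCharacter ℂ q₁) (χ₂ : DirichletCharacter ℂ q₂)
    (r a : ℤ) {t : ℂ} (ht : t ≠ 0) :
    Summable fun n : ℤ ↦ cuspWeight χ₁ χ₂ r n a / (n * t - q₂ * a) ^ 2 := by
  have h := (EisensteinSeries.linear_left_summable ht (-(q₂ * a)) (k := 2) le_rfl).norm
  refine Summable.of_norm_bounded h fun n ↦ ?_
  rw [div_eq_mul_inv, norm_mul]
  refine (mul_le_of_le_one_left (norm_nonneg _) (norm_cuspWeight_le χ₁ χ₂ r n a)).trans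
    (le_of_eq ?_)
  simp [zpow_ofNat, sub_eq_add_neg]

omit [NeZero q₁] in
-- This is the Lipschitz formula at `τ = a (r / q₂ - 1 / t)`: since `n t - q₂ a = t (q₂ τ + (n - a
-- r))`, shifting the index by `a r` produces the weight.
lemma hasSum_cuspWeight_div_sq (hχ₂ : χ₂.IsPrimitive) {t : ℂ} (ht : 0 < t.im) (a : ℕ+) :
    HasSum (fun n : ℤ ↦ cuspWeight χ₁ χ₂ r n (a : ℕ) / (n * t - q₂ * (a : ℕ)) ^ 2)
      ((2 * Real.pi * I / q₂) ^ 2 * gaussSum χ₂ ZMod.stdAddChar / t ^ 2 *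
        (χ₁ (a : ZMod q₁) * ∑' b : ℕ+, χ₂⁻¹ (b : ZMod q₂) * (b : ℂ) *
          exp (2 * Real.pi * I * (a * (r / q₂ - 1 / t))) ^ (b : ℕ))) := by
  have ht0 : t ≠ 0 := by rintro rfl; simp at ht
  have hq₂ : (q₂ : ℂ) ≠ 0 := NeZero.ne _
  have him : 0 < ((a : ℂ) * (r / q₂ - 1 / t)).im := by
    have h := mul_pos (Nat.cast_pos (α := ℝ).mpr a.pos) (sub_inv_im_pos r q₂ ht)
    rwa [← Complex.im_ofReal_mul, Complex.ofReal_natCast] at h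
  have h := (hasSum_lipschitz hχ₂ him).mul_left (χ₁ (a : ZMod q₁) / t ^ 2)
  rw [← (Equiv.subRight ((a : ℕ) * r : ℤ)).hasSum_iff] at h
  have hval (c g T : ℂ) : c * g / t ^ 2 * (χ₁ (a : ZMod q₁) * T) =
      χ₁ (a : ZMod q₁) / t ^ 2 * (c * g * T) := by ring
  rw [hval]
  refine h.congr_fun fun n ↦ ?_
  simp only [Function.comp_apply, Equiv.subRight_apply, cuspWeight]
  have e : (n * t - q₂ * (a : ℕ) : ℂ) =
      t * (q₂ * ((a : ℕ) * (r / q₂ - 1 / t)) + (n - (a : ℕ) * r : ℤ)) := by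
    push_cast; field_simp; ring
  rw [e, mul_pow, div_mul_div_comm]
  push_cast
  rfl

/-- The derivative of `F` at the cusp `r / q₂` as a sum over the lattice. -/
lemma tsum_block_cuspWeight_eq (hcop : q₁.Coprime q₂) (hq₁ : q₁ ≠ 1) (hχ₁ : χ₁.IsPrimitive)
    (hχ₂ : χ₂.IsPrimitive) (hpar : χ₁ (-1) * χ₂ (-1) = 1) {t : ℂ} (ht : 0 < t.im) :
    ∑' x, block (cuspWeight χ₁ χ₂ r) (q₁ * q₂) q₂ t x =
      2 * ((2 * Real.pi * I / q₂) ^ 2 * gaussSum χ₂ ZMod.stdAddChar / t ^ 2 *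
        ∑' x, qTermDeriv χ₁ χ₂ x (r / q₂ - 1 / t)) := by
  have ht0 : t ≠ 0 := by rintro rfl; simp at ht
  refine tsum_block_eq (z := ⟨t, ht⟩) (NeZero.ne q₂) (norm_cuspWeight_le χ₁ χ₂ r)
    (sum_cuspWeight χ₂ r hcop (ne_one_of_isPrimitive hχ₁ hq₁))
    (fun n a l ↦ cuspWeight_add χ₁ χ₂ r n a l)
    (fun a ↦ (summable_cuspWeight_div_sq χ₁ χ₂ r a ht0).hasSum) ?_
  refine hasSum_int_of_even (fun a ↦ ?_) ?_ ?_
  · rw [← (Equiv.neg ℤ).tsum_eq]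
    refine tsum_congr fun n ↦ ?_
    rw [Equiv.neg_apply, cuspWeight_neg r hpar]
    push_cast
    ring
  · simp [cuspWeight_zero_right χ₁ χ₂ r hq₁]
  · refine ((hasSum_qTermDeriv_fiberwise χ₁ χ₂ (sub_inv_im_pos r q₂ ht)).mul_left _).congr_fun
      fun a ↦ ?_
    exact (hasSum_cuspWeight_div_sq hχ₂ ht a).tsum_eq

/-- The factor `1 / t ^ 2` from the chain rule is the one carried by the lattice sum, so the
derivative in `t` is a constant times that sum. -/
lemma hasDerivAt_tsum_qTerm_cusp (hcop : q₁.Coprime q₂) (hq₁ : q₁ ≠ 1) (hχ₁ : χ₁.IsPrimitive)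
    (hχ₂ : χ₂.IsPrimitive) (hpar : χ₁ (-1) * χ₂ (-1) = 1) {t : ℂ} (ht : 0 < t.im) :
    HasDerivAt (fun w : ℂ ↦ ∑' x, qTerm χ₁ χ₂ x (r / q₂ - 1 / w))
      (q₂ ^ 2 / (4 * Real.pi * I * gaussSum χ₂ ZMod.stdAddChar) *
        ∑' x, block (cuspWeight χ₁ χ₂ r) (q₁ * q₂) q₂ t x) t := by
  have ht0 : t ≠ 0 := by rintro rfl; simp at ht
  have hq₂ : (q₂ : ℂ) ≠ 0 := NeZero.ne _
  have hτ := gaussSum_ne_zero_of_isPrimitive hχ₂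
  have hπ : (Real.pi : ℂ) ≠ 0 := ofReal_ne_zero.mpr Real.pi_ne_zero
  have hinner : HasDerivAt (fun w : ℂ ↦ (r : ℂ) / q₂ - 1 / w) (1 / t ^ 2) t := by
    have := (hasDerivAt_inv ht0).const_sub ((r : ℂ) / q₂)
    simpa [one_div] using this
  refine ((hasDerivAt_tsum_qTerm χ₁ χ₂ (sub_inv_im_pos r q₂ ht)).comp t hinner).congr_deriv ?_
  rw [tsum_block_cuspWeight_eq hcop hq₁ hχ₁ hχ₂ hpar ht]
  field_simp
  ring

/-- The parabolic period of `F` at the cusp `r / q₂` is a nonzero multiple of the translation. -/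
lemma exists_cusp_period (hcop : q₁.Coprime q₂) (hq₁ : q₁ ≠ 1) (hχ₁ : χ₁.IsPrimitive)
    (hχ₂ : χ₂.IsPrimitive) (hpar : χ₁ (-1) * χ₂ (-1) = 1) (hr : IsCoprime r (q₂ : ℤ)) :
    ∃ C : ℂ, C ≠ 0 ∧ ∀ (k : ℤ) (t : ℂ), 0 < t.im →
      ∑' x, qTerm χ₁ χ₂ x (r / q₂ - 1 / (t + (q₂ * (q₁ * q₂ : ℕ) * k : ℤ))) -
        ∑' x, qTerm χ₁ χ₂ x (r / q₂ - 1 / t) = C * (q₂ * (q₁ * q₂ : ℕ) * k : ℤ) := by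
  obtain ⟨C, hC, hsum⟩ := exists_hasSum_cuspWeight_zero hpar hr
  have hq₂ : (q₂ : ℂ) ≠ 0 := NeZero.ne _
  have hτ := gaussSum_ne_zero_of_isPrimitive hχ₂
  have hπ : (Real.pi : ℂ) ≠ 0 := ofReal_ne_zero.mpr Real.pi_ne_zero
  set κ : ℂ := q₂ ^ 2 / (4 * Real.pi * I * gaussSum χ₂ ZMod.stdAddChar) with hκ
  have hκ0 : κ ≠ 0 := div_ne_zero (pow_ne_zero 2 hq₂)
    (mul_ne_zero (mul_ne_zero (mul_ne_zero (by norm_num) hπ) I_ne_zero) hτ)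
  refine ⟨κ * C, mul_ne_zero hκ0 hC, fun k t ht ↦ ?_⟩
  have key := add_period_sub_eq (C := κ * C) (h := ((q₂ * (q₁ * q₂ : ℕ) * k : ℤ) : ℝ))
    (fun t ht ↦ hasDerivAt_tsum_qTerm_cusp (r := r) hcop hq₁ hχ₁ hχ₂ hpar ht)
    (fun t _ ↦ ?_) (fun A ↦ ?_) ht
  · simpa only [ofReal_intCast] using key
  · congr 1
    rw [← tsum_block_add t k]
    push_cast
    rfl
  · exact (tendsto_tsum_block (NeZero.ne q₂) (norm_cuspWeight_le χ₁ χ₂ r)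
      (sum_cuspWeight χ₂ r hcop (ne_one_of_isPrimitive hχ₁ hq₁)) A
      (fun n a l ↦ cuspWeight_add χ₁ χ₂ r n a l) hsum).const_mul κ

omit [NeZero q₁] [NeZero q₂] in
variable (χ₁ χ₂) in
lemma qTerm_add_int (x : ℕ+ × ℕ+) (z : ℂ) (n : ℤ) :
    qTerm χ₁ χ₂ x (z + n) = qTerm χ₁ χ₂ x z := by
  rw [qTerm, mul_add, Complex.exp_add, qTerm]
  have : exp (2 * Real.pi * I * ((x.1 * x.2 : ℕ) : ℂ) * n) = 1 :=
    Complex.exp_eq_one_iff.mpr ⟨(x.1 * x.2 : ℕ) * n, by push_cast; ring⟩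
  rw [this, mul_one]

omit [NeZero q₁] [NeZero q₂] in
lemma psi_eq_one (hpar : χ₁ (-1) * χ₂ (-1) = 1) {ε : ℤ} (hε : ε = 1 ∨ ε = -1) {γ : SL(2, ℤ)}
    (h1 : ((γ 1 1 : ℤ) : ZMod q₁) = ε) (h2 : ((γ 1 1 : ℤ) : ZMod q₂) = ε) :
    psi χ₁ χ₂ γ = 1 := by
  rw [psi, h1, h2]
  rcases hε with rfl | rfl
  · simp
  · have hsq : χ₂⁻¹ (-1) = χ₂ (-1) := by
      rw [MulChar.inv_apply_eq_inv']
      refine inv_eq_of_mul_eq_one_left ?_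
      rw [← map_mul, neg_mul_neg, one_mul, map_one]
    push_cast
    rw [hsq, hpar]

/-- Matrices with the same left column differ by right translation by an integer `n`, so it suffices
to treat one that fixes `r / q₂` and to move this cusp to infinity. -/
lemma exists_gamma_smul_eq {N : ℕ} (hN : q₁ * q₂ = N) {k : ℤ} (hk : k ≠ 0) {ε : ℤ}
    (hε : ε = 1 ∨ ε = -1) {γ : SL(2, ℤ)} (ha : γ 0 0 = ε + N * k * r)
    (hc : γ 1 0 = N * k * q₂) :
    ∃ n : ℤ, γ 1 1 = ε - N * k * r + n * (N * k * q₂) ∧ ∀ z : UpperHalfPlane, ∃ t : ℂ, 0 < t.im ∧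
      (z : ℂ) = r / q₂ - 1 / t - n ∧
      ((γ • z : UpperHalfPlane) : ℂ) = r / q₂ - 1 / (t + (q₂ * (q₁ * q₂ : ℕ) * (-ε * k) : ℤ)) := by
  have hdet : γ 0 0 * γ 1 1 - γ 0 1 * γ 1 0 = 1 := by
    have := γ.det_coe
    rwa [Matrix.det_fin_two] at this
  have hNk : (N * k * q₂ : ℤ) ≠ 0 := by
    subst hN
    have h1 : ((q₁ * q₂ : ℕ) : ℤ) ≠ 0 := by exact_mod_cast NeZero.ne (q₁ * q₂)
    have h2 : (q₂ : ℤ) ≠ 0 := by exact_mod_cast NeZero.ne q₂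
    exact mul_ne_zero (mul_ne_zero h1 hk) h2
  have hε2 : ε * ε = 1 := by rcases hε with rfl | rfl <;> rfl
  have hNq : (N : ℤ) = q₁ * q₂ := by subst hN; push_cast; rfl
  -- The upper right entry for which `(r, q₂)` is an eigenvector with eigenvalue `ε`.
  set b₀ : ℤ := -(q₁ * k * r ^ 2) with hb₀
  have hdet0 : (ε + N * k * r) * (ε - N * k * r) - b₀ * (N * k * q₂) = 1 := by
    rw [hb₀, hNq]; linear_combination hε2
  rw [ha, hc] at hdet
  have hcopr : IsCoprime (N * k * q₂ : ℤ) (ε + N * k * r) :=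
    ⟨-b₀, ε - N * k * r, by linear_combination hdet0⟩
  obtain ⟨n, hn⟩ : (N * k * q₂ : ℤ) ∣ γ 1 1 - (ε - N * k * r) :=
    hcopr.dvd_of_dvd_mul_left ⟨γ 0 1 - b₀, by linear_combination hdet - hdet0⟩
  have hd : γ 1 1 = ε - N * k * r + n * (N * k * q₂) := by linear_combination hn
  have hb : γ 0 1 = b₀ + n * (ε + N * k * r) := by
    refine mul_left_cancel₀ hNk ?_
    rw [hd] at hdet
    linear_combination hdet0 - hdet
  refine ⟨n, hd, fun z ↦ ?_⟩
  set w : ℂ := z + n - r / q₂ with hw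
  have hq₂ : (q₂ : ℂ) ≠ 0 := NeZero.ne _
  have hwim : w.im = z.im := by
    have : ((r : ℂ) / q₂) = ((r / q₂ : ℝ) : ℂ) := by push_cast; rfl
    rw [hw, this]; simp
  have hw0 : w ≠ 0 := by
    intro h; rw [h] at hwim; exact z.im_pos.ne hwim
  -- `w` is the displacement of `z + n` from the cusp.
  refine ⟨-1 / w, ?_, ?_, ?_⟩
  · rw [neg_div, one_div, neg_im, inv_im, neg_div, neg_neg, hwim]
    exact div_pos z.im_pos (normSq_pos.mpr hw0)
  · rw [hw, one_div_div, div_neg, div_one]; ring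
  · have hεC : (ε : ℂ) * ε = 1 := by exact_mod_cast hε2
    have hε0 : (ε : ℂ) ≠ 0 := left_ne_zero_of_mul_eq_one hεC
    have hz : (z : ℂ) = w - n + r / q₂ := by rw [hw]; ring
    have hD : (ε : ℂ) + (N * k * q₂ : ℤ) * w ≠ 0 := by
      intro h
      have him := congrArg Complex.im h
      rw [add_im, intCast_im, zero_add, ← ofReal_intCast, im_ofReal_mul, zero_im, hwim] at him
      exact mul_ne_zero (Int.cast_ne_zero.mpr hNk) z.im_pos.ne' him
    have e1 : -1 / w + (q₂ * (q₁ * q₂ : ℕ) * (-ε * k) : ℤ) =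
        -(ε * (ε + (N * k * q₂ : ℤ) * w)) / w := by
      rw [hN]
      push_cast
      field_simp
      linear_combination hεC
    rw [UpperHalfPlane.coe_specialLinearGroup_apply, ha, hb, hc, hd, e1, one_div_div, hz]
    simp only [algebraMap_int_eq, eq_intCast, ofReal_intCast]
    have e2 : ((N * k * q₂ : ℤ) : ℂ) * (w - n + r / q₂) +
        ((ε - N * k * r + n * (N * k * q₂) : ℤ) : ℂ) = ε + (N * k * q₂ : ℤ) * w := by
      push_cast; field_simp; ring
    have e3 : ((ε + N * k * r : ℤ) : ℂ) * (w - n + r / q₂) +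
        ((b₀ + n * (ε + N * k * r) : ℤ) : ℂ) =
        r / q₂ * (ε + (N * k * q₂ : ℤ) * w) + ε * w := by
      rw [hb₀, ← hN]; push_cast; field_simp; ring
    rw [e2, e3, add_div, mul_div_cancel_right₀ _ hD, div_neg, sub_neg_eq_add]
    congr 1
    rw [div_eq_div_iff hD (mul_ne_zero hε0 hD)]
    linear_combination (w * (ε + (N * k * q₂ : ℤ) * w)) * hεC

end Cusp

end NewformDedekind

/-! ### Nonvanishing of the Dedekind sum. -/

theorem mainTheorem4 (q₁ q₂ N : ℕ) [NeZero q₁] [NeZero q₂] (hN : q₁ * q₂ = N)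
    (hcop : Nat.Coprime q₁ q₂) (hq₁ : q₁ ≠ 1)
    (χ₁ : DirichletCharacter ℂ q₁) (χ₂ : DirichletCharacter ℂ q₂)
    (hχ₁ : χ₁.IsPrimitive) (hχ₂ : χ₂.IsPrimitive) (hpar : χ₁ (-1) * χ₂ (-1) = 1)
    (r : ℤ) (hr : IsCoprime r (q₂ : ℤ)) (k : ℤ) (hk : k ≠ 0) (ε : ℤ) (hε : ε = 1 ∨ ε = -1) :
    ∃ s : ℂ, NewformDedekind.HasDedekindSum χ₁ χ₂ (ε + N * k * r) (N * k * q₂) s ∧ s ≠ 0 := by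
  open NewformDedekind in
  obtain ⟨C, hC, hperiod⟩ := exists_cusp_period hcop hq₁ hχ₁ hχ₂ hpar hr
  have hε2 : ε * ε = 1 := by rcases hε with rfl | rfl <;> rfl
  have hε0 : ε ≠ 0 := left_ne_zero_of_mul_eq_one hε2
  have hχ₁inv : χ₁⁻¹.IsPrimitive := by
    rwa [DirichletCharacter.isPrimitive_def, DirichletCharacter.conductor_inv]
  have hh : (q₂ * (q₁ * q₂ : ℕ) * (-ε * k) : ℤ) ≠ 0 := by
    have h1 : ((q₁ * q₂ : ℕ) : ℤ) ≠ 0 := by exact_mod_cast NeZero.ne (q₁ * q₂)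
    have h2 : (q₂ : ℤ) ≠ 0 := by exact_mod_cast NeZero.ne q₂
    exact mul_ne_zero (mul_ne_zero h2 h1) (mul_ne_zero (neg_ne_zero.mpr hε0) hk)
  refine ⟨gaussSum χ₁⁻¹ ZMod.stdAddChar / ((Real.pi : ℂ) * Complex.I) *
    (C * (q₂ * (q₁ * q₂ : ℕ) * (-ε * k) : ℤ)), ⟨?_, ?_⟩, ?_⟩
  · let M : Matrix (Fin 2) (Fin 2) ℤ :=
      !![ε + N * k * r, -(q₁ * k * r ^ 2); N * k * q₂, ε - N * k * r]
    have hM : M.det = 1 := by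
      rw [Matrix.det_fin_two_of, ← hN]
      push_cast
      linear_combination hε2
    refine ⟨⟨M, hM⟩, CongruenceSubgroup.Gamma0_mem.mpr ?_, rfl, rfl⟩
    change ((N * k * q₂ : ℤ) : ZMod (q₁ * q₂)) = 0
    rw [← hN]
    push_cast
    rw [← Nat.cast_mul, ZMod.natCast_self, zero_mul, zero_mul]
  · intro γ _ ha hc z
    obtain ⟨n, hd, hz⟩ := exists_gamma_smul_eq hN hk hε ha hc
    obtain ⟨t, ht, hzt, hγz⟩ := hz z
    have hψ : psi χ₁ χ₂ γ = 1 := by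
      refine psi_eq_one hpar hε ?_ ?_ <;> rw [hd, ← hN] <;> push_cast <;> simp
    -- As `ψ(γ) = 1`, the constant terms of `F` cancel; the remaining translation by `n` is absorbed
    -- by the periodicity of each term.
    rw [dedekindSumAt, phi, hψ, one_mul, F_eq_tsum_qTerm χ₁ χ₂ hq₁, F_eq_tsum_qTerm χ₁ χ₂ hq₁,
      add_sub_add_left_eq_sub, ← hperiod _ t ht, hγz, hzt]
    congr 3
    ext x
    rw [sub_eq_add_neg _ (n : ℂ), ← Int.cast_neg, qTerm_add_int]
  · refine mul_ne_zero (div_ne_zero (gaussSum_ne_zero_of_isPrimitive hχ₁inv)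
      (mul_ne_zero (Complex.ofReal_ne_zero.mpr Real.pi_ne_zero) Complex.I_ne_zero))
      (mul_ne_zero hC (Int.cast_ne_zero.mpr hh))
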